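/- Let $m>0$ be an integer. An *$x$-monotone lattice path* is a path in $\mathbb Z^2$ with unit steps right, up or down, going from the line $\{x=0\}$ to the line $\{x=m\}$. Let $\Gamma$ be an infinite strip with one or two ends, that is, the region consisting of those lattice points and lattice edges of the strip $\{0\le x\le m\}$ which lie on or below an $x$-monotone lattice path $\eta_+$ (one end, no lower boundary), or of those which lie on or above an $x$-monotone lattice path $\eta_-$ (one end, no upper boundary), or of all of them (two ends). Let $\alpha=\Gamma\cap\{x=0\}$ and $\beta=\Gamma\cap\{x=m\}$ be its vertical sides, each of which is a vertical ray or line, and suppose that the origin $O$ lies in $\alpha$. Let $\{X_t\}$ be the nearest neighbor lattice random walk on $\mathbb Z^2$ (each of the four unit steps has probability $\frac14$, independently of the past) which starts at $X_0=O$ and is absorbed whenever $X_t$ tries to exit the region $\Gamma$. Denote by $T$ the first time $t$ such that $X_t\in\beta$, and let $p(k)$ be the probability that $T$ exists and $X_T=(m,k)$. Then $\{p(k)\}$ is log-concave: $$p(k)^2\ \ge\ p(k+1)\,p(k-1)\qquad\text{for all } k\in\mathbb Z \text{ such that } (m,k\pm1)\in\beta.$$ -/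

import Mathlib

open MeasureTheory ProbabilityTheory

/-- An `x`-monotone lattice path from the line `x = 0` to the line `x = m`: the points
`pt 0, pt 1, …, pt length` of `ℤ²`, consecutive ones being joined by a unit step to the right,
up or down.  (The values `pt i` with `i > length` play no role.) -/
structure XMonotonePath (m : ℕ) where
  length : ℕ
  pt : ℕ → ℤ × ℤ
  start : (pt 0).1 = 0
  finish : (pt length).1 = m
  step : ∀ i < length, pt (i + 1) - pt i ∈ ({(1, 0), (0, 1), (0, -1)} : Set (ℤ × ℤ))

namespace XMonotonePath

variable {m : ℕ}

/-- The lattice point `v` lies on or below the path. -/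
def PointBelow (η : XMonotonePath m) (v : ℤ × ℤ) : Prop :=
  ∃ i ≤ η.length, (η.pt i).1 = v.1 ∧ v.2 ≤ (η.pt i).2

/-- The lattice point `v` lies on or above the path. -/
def PointAbove (η : XMonotonePath m) (v : ℤ × ℤ) : Prop :=
  ∃ i ≤ η.length, (η.pt i).1 = v.1 ∧ (η.pt i).2 ≤ v.2

/-- The horizontal unit edge between `u` and `v` lies on or below the path: it lies weakly below
the horizontal edge of the path which has the same projection to the `x`-axis. -/
def HEdgeBelow (η : XMonotonePath m) (u v : ℤ × ℤ) : Prop :=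
  ∃ i < η.length, (η.pt i).1 = min u.1 v.1 ∧ (η.pt (i + 1)).1 = max u.1 v.1 ∧ u.2 ≤ (η.pt i).2

/-- The horizontal unit edge between `u` and `v` lies on or above the path. -/
def HEdgeAbove (η : XMonotonePath m) (u v : ℤ × ℤ) : Prop :=
  ∃ i < η.length, (η.pt i).1 = min u.1 v.1 ∧ (η.pt (i + 1)).1 = max u.1 v.1 ∧ (η.pt i).2 ≤ u.2

end XMonotonePath

/-- An infinite strip: the part of the strip `0 ≤ x ≤ m` (with `m > 0`) below an upper boundary
path `η₊`, or above a lower boundary path `η₋`, or the whole strip; at least one of the two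
boundary paths is absent (`none`).  It has one end if exactly one of them is absent, and two ends
if both are. -/
structure InfiniteStrip where
  m : ℕ
  m_pos : 0 < m
  upper : Option (XMonotonePath m)
  lower : Option (XMonotonePath m)
  unbounded : upper = none ∨ lower = none

namespace InfiniteStrip

/-- The lattice points of the region, its boundary included. -/
def points (Γ : InfiniteStrip) : Set (ℤ × ℤ) :=
  {v | 0 ≤ v.1 ∧ v.1 ≤ Γ.m ∧
    (∀ η ∈ Γ.upper, η.PointBelow v) ∧ (∀ η ∈ Γ.lower, η.PointAbove v)}

/-- The left side of the region. -/
def α (Γ : InfiniteStrip) : Set (ℤ × ℤ) := {v ∈ Γ.points | v.1 = 0}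

/-- The right side of the region. -/
def β (Γ : InfiniteStrip) : Set (ℤ × ℤ) := {v ∈ Γ.points | v.1 = Γ.m}

/-- The step from `u` to the neighbouring lattice point `v` stays in the region: both end points
belong to the region, and so does the edge between them.  For a vertical edge the latter is
automatic, since each column of the region is an interval, ray or line. -/
def StepInside (Γ : InfiniteStrip) (u v : ℤ × ℤ) : Prop :=
  u ∈ Γ.points ∧ v ∈ Γ.points ∧
    (u.1 ≠ v.1 → (∀ η ∈ Γ.upper, η.HEdgeBelow u v) ∧ (∀ η ∈ Γ.lower, η.HEdgeAbove u v))

open Classical in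
/-- The trajectory `x`, absorbed as soon as it tries to make a step out of the region;
`none` stands for the absorbed state. -/
noncomputable def absorbed (Γ : InfiniteStrip) (x : ℕ → ℤ × ℤ) : ℕ → Option (ℤ × ℤ)
  | 0 => some (x 0)
  | t + 1 => (Γ.absorbed x t).bind fun u =>
      if Γ.StepInside u (x (t + 1)) then some (x (t + 1)) else none

/-- The first time `T` at which the absorbed trajectory is in `β` exists, and its position at
that time is `(m, k)`. -/
def ExitsAt (Γ : InfiniteStrip) (x : ℕ → ℤ × ℤ) (k : ℤ) : Prop :=
  ∃ T, Γ.absorbed x T = some ((Γ.m : ℤ), k) ∧ ∀ t < T, ∀ v ∈ Γ.β, Γ.absorbed x t ≠ some v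

/-- The exit probability `p(k)` of the random trajectory `X`. -/
noncomputable def exitProb {Ω : Type*} [MeasurableSpace Ω] (Γ : InfiniteStrip) (μ : Measure Ω)
    (X : ℕ → Ω → ℤ × ℤ) (k : ℤ) : ℝ :=
  μ.real {ω | Γ.ExitsAt (fun t => X t ω) k}

end InfiniteStrip

/-- `X` is the nearest neighbor (simple) random walk on `ℤ²` started at the origin: its
increments are independent, each uniformly distributed on the four unit vectors. -/
structure IsSimpleRandomWalk {Ω : Type*} [MeasurableSpace Ω] (μ : Measure Ω)
    (X : ℕ → Ω → ℤ × ℤ) : Prop where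
  measurable : ∀ t, Measurable (X t)
  start : ∀ ω, X 0 ω = (0, 0)
  indep : iIndepFun (fun t ω => X (t + 1) ω - X t ω) μ
  uniform : ∀ t, ∀ e ∈ ({(1, 0), (-1, 0), (0, 1), (0, -1)} : Set (ℤ × ℤ)),
    μ {ω | X (t + 1) ω - X t ω = e} = 1 / 4

/-!
The exit probability `p k` is the value at the origin of a function `K k` on the lattice, the
probability of exiting at `(m, k)` as a function of the starting point; it is harmonic for the walk
killed at forbidden edges and equals the indicator of `(m, k)` on the line `x = m`
(`IsSimpleRandomWalk.exitProb_eq_exitFunction`, which is the Markov property).  By a reflection it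
may be assumed that the region `Γ` has no lower boundary.  Let `Γ'` be `Γ` translated up by
`(0, 1)`, so `Γ ⊆ Γ'`.  Write `f, g` for the exit functions of `Γ` with exit points `(m, k + 1)` and
`(m, k)`, and `f', g'` for those of `Γ'` with the same exit points.  With `O' = O + (0, 1)`, translation
invariance gives `f' O' = p k` and `g' O' = p (k - 1)`, so log-concavity says that
`f O * g' O' ≤ g O * f' O'`, which follows from two comparisons.

* In the single region `Γ'`, `f' u * g' b ≤ g' u * f' b` whenever `u` is on the left side and `b` is
  above `u`, or is on the upper boundary
  (`IsExitFunction.mul_le_mul_of_exposedAbove`).  If this fails, a combination `s * f' - t * g'` with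
  `s, t > 0` is positive at `u` and negative at `b`.  By the maximum principle
  (`nonpos_of_subharmonic`) `u` is joined to the upper exit point by a walk through points where the
  combination is positive, and `b` to the lower one by a walk through points where it is negative
  (`reachable_of_pos`).  Such walks have a common point (`walks_cross`), which is absurd.  The crossing
  is proved by counting, modulo 2, the horizontal edges of the first walk above a point of the second.

* When the region grows from `Γ` to `Γ'`, `f O * g' O ≤ g O * f' O`
  (`IsExitFunction.mul_le_mul_of_subgraph`).  The function `ψ' = f' O * g' - g' O * f'` vanishes at `O`
  and is nonpositive at the ends of the new edges, which are on the upper boundary, by the first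
  comparison.  Hence `ψ' - (f' O * g - g' O * f)` is subharmonic in `Γ` with zero boundary values, and
  it is nonpositive; at `O` this is the claim.
-/

/-! ### Harmonic functions of a walk killed on forbidden edges -/

/-- The four unit steps of the lattice `ℤ²`. -/
def unitSteps : Finset (ℤ × ℤ) := {(1, 0), (-1, 0), (0, 1), (0, -1)}

lemma sum_unitSteps {M : Type*} [AddCommMonoid M] (f : ℤ × ℤ → M) :
    ∑ e ∈ unitSteps, f e = f (1, 0) + f (-1, 0) + f (0, 1) + f (0, -1) := by
  simp [unitSteps, add_assoc]

open Classical in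
/-- The one-step average of `φ` for the nearest neighbor walk which is killed when it tries to
make a step that is not allowed by the relation `E`. -/
noncomputable def stepMean (E : ℤ × ℤ → ℤ × ℤ → Prop) (φ : ℤ × ℤ → ℝ) (z : ℤ × ℤ) : ℝ :=
  1 / 4 * ∑ e ∈ unitSteps, if E z (z + e) then φ (z + e) else 0

lemma stepMean_mono {E F : ℤ × ℤ → ℤ × ℤ → Prop} {φ ψ : ℤ × ℤ → ℝ} {z : ℤ × ℤ}
    (hEF : ∀ e ∈ unitSteps, E z (z + e) → F z (z + e))
    (h : ∀ e ∈ unitSteps, E z (z + e) → φ (z + e) ≤ ψ (z + e)) (hψ : ∀ z, 0 ≤ ψ z) :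
    stepMean E φ z ≤ stepMean F ψ z := by
  unfold stepMean
  refine mul_le_mul_of_nonneg_left (Finset.sum_le_sum fun e he => ?_) (by norm_num)
  by_cases hE : E z (z + e)
  · simpa [hE, hEF e he hE] using h e he hE
  · simp only [hE, if_false]
    split_ifs
    exacts [hψ _, le_rfl]

/-- The functional `stepMean` is linear; this is the combination of two functions used below. -/
lemma stepMean_sub_mul (E : ℤ × ℤ → ℤ × ℤ → Prop) (f g : ℤ × ℤ → ℝ) (s t : ℝ) (z : ℤ × ℤ) :
    stepMean E (fun z => s * f z - t * g z) z = s * stepMean E f z - t * stepMean E g z := by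
  simp only [stepMean, sum_unitSteps]
  split_ifs <;> ring

/-- One round of the maximum principle: from a point with `m - j ≤ x` the walk leaves the strip
within `j` steps with probability at least `4⁻ʲ`, by going right all the time. -/
lemma le_contraction_of_subharmonic {m : ℤ} {ψ : ℤ × ℤ → ℝ} {B : ℝ} (hB : 0 ≤ B)
    (hψB : ∀ z, ψ z ≤ B)
    (hψ : ∀ z, 0 < ψ z → 0 ≤ z.1 ∧ z.1 < m ∧
      ψ z ≤ 1 / 4 * ∑ e ∈ unitSteps, max (ψ (z + e)) 0) (j : ℕ) :
    ∀ z : ℤ × ℤ, m - j ≤ z.1 → ψ z ≤ (1 - (1 / 4 : ℝ) ^ j) * B := by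
  have hfac : ∀ j : ℕ, 0 ≤ (1 - (1 / 4 : ℝ) ^ j) * B := fun j =>
    mul_nonneg (sub_nonneg.2 (pow_le_one₀ (by norm_num) (by norm_num))) hB
  induction j with
  | zero =>
    intro z hz
    by_contra! h
    have := (hψ z ((hfac 0).trans_lt h)).2.1
    push_cast at hz
    omega
  | succ j ih =>
    intro z hz
    by_contra! h
    obtain ⟨-, -, h1⟩ := hψ z ((hfac _).trans_lt h)
    rw [sum_unitSteps] at h1
    have h2 : max (ψ (z + (1, 0))) 0 ≤ (1 - (1 / 4 : ℝ) ^ j) * B :=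
      max_le (ih _ (by push_cast at hz; simp only [Prod.fst_add]; omega)) (hfac j)
    have h3 := max_le (hψB (z + (-1, 0))) hB
    have h4 := max_le (hψB (z + (0, 1))) hB
    have h5 := max_le (hψB (z + (0, -1))) hB
    have h6 : (1 - (1 / 4 : ℝ) ^ (j + 1)) * B
        = 1 / 4 * ((1 - (1 / 4 : ℝ) ^ j) * B + B + B + B) := by ring
    linarith

/-- Maximum principle on the strip `0 ≤ x ≤ m`: a function which is bounded above and which is
subharmonic with zero boundary values wherever it is positive is nowhere positive.  The strip is
infinite, but its width is finite, so the walk leaves it almost surely. -/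
lemma nonpos_of_subharmonic {m : ℤ} {ψ : ℤ × ℤ → ℝ} {M : ℝ} (hM : ∀ z, ψ z ≤ M)
    (hψ : ∀ z, 0 < ψ z → 0 ≤ z.1 ∧ z.1 < m ∧
      ψ z ≤ 1 / 4 * ∑ e ∈ unitSteps, max (ψ (z + e)) 0) (z : ℤ × ℤ) : ψ z ≤ 0 := by
  set q : ℝ := 1 - (1 / 4 : ℝ) ^ m.toNat with hq
  have hq0 : 0 ≤ q := sub_nonneg.2 (pow_le_one₀ (by norm_num) (by norm_num))
  have hq1 : q < 1 := by
    have : (0 : ℝ) < (1 / 4 : ℝ) ^ m.toNat := by positivity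
    linarith
  have hB0 : 0 ≤ max M 0 := le_max_right _ _
  have key : ∀ n : ℕ, ∀ z, ψ z ≤ q ^ n * max M 0 := by
    intro n
    induction n with
    | zero => intro z; simpa using Or.inl (hM z)
    | succ n ih =>
      intro z
      by_contra! h
      have hpos : 0 < ψ z := lt_of_le_of_lt (by positivity) h
      have h0 := (hψ z hpos).1
      have := le_contraction_of_subharmonic (by positivity) ih hψ m.toNat z (by omega)
      rw [← hq, ← mul_assoc, ← pow_succ'] at this
      linarith
  have hlim : Filter.Tendsto (fun n : ℕ => q ^ n * max M 0) Filter.atTop (nhds 0) := by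
    simpa using (tendsto_pow_atTop_nhds_zero_of_lt_one hq0 hq1).mul_const (max M 0)
  exact ge_of_tendsto' hlim fun n => key n z

/-- The relation of making an allowed unit step that ends in `P`. -/
def StepInto (E : ℤ × ℤ → ℤ × ℤ → Prop) (P : Set (ℤ × ℤ)) (a b : ℤ × ℤ) : Prop :=
  (∃ e ∈ unitSteps, b = a + e) ∧ E a b ∧ b ∈ P

/-- If a bounded function is harmonic inside the strip and vanishes on the line `x = m` except
for a positive value at `c`, then `c` can be reached from every point where the function is
positive, by a walk through such points: otherwise the function, restricted to the points that
can be reached, would contradict the maximum principle. -/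
lemma reachable_of_pos {E : ℤ × ℤ → ℤ × ℤ → Prop} {m : ℤ} {φ : ℤ × ℤ → ℝ} {c : ℤ × ℤ} {M : ℝ}
    (hM : ∀ z, φ z ≤ M)
    (hφ : ∀ z, 0 < φ z → z ≠ c → 0 ≤ z.1 ∧ z.1 < m ∧ φ z = stepMean E φ z)
    {z : ℤ × ℤ} (hz : 0 < φ z) :
    Relation.ReflTransGen (StepInto E {v | 0 < φ v}) z c := by
  classical
  by_contra hc
  set S : Set (ℤ × ℤ) := {v | Relation.ReflTransGen (StepInto E {v | 0 < φ v}) z v} with hS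
  have hpos : ∀ v ∈ S, 0 < φ v := by
    intro v hv
    rcases Relation.ReflTransGen.cases_tail hv with h | ⟨w, -, h⟩
    · rwa [h]
    · exact h.2.2
  set ψ : ℤ × ℤ → ℝ := fun v => if v ∈ S then φ v else 0 with hψ
  have hψM : ∀ v, ψ v ≤ max M 0 := by
    intro v
    simp only [hψ]
    split_ifs
    exacts [(hM v).trans (le_max_left _ _), le_max_right _ _]
  have hzS : z ∈ S := Relation.ReflTransGen.refl
  have := nonpos_of_subharmonic (m := m) hψM (fun v hv => ?_) z
  · simp only [hψ, hzS, if_true] at this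
    linarith
  · have hvS : v ∈ S := by
      by_contra h
      simp [hψ, h] at hv
    obtain ⟨h0, h1, h2⟩ := hφ v (hpos v hvS) (fun h => hc (h ▸ hvS))
    refine ⟨h0, h1, ?_⟩
    simp only [hψ, hvS, if_true]
    rw [h2, stepMean]
    refine mul_le_mul_of_nonneg_left (Finset.sum_le_sum fun e he => ?_) (by norm_num)
    split_ifs with hE hS'
    · exact le_max_left _ _
    · refine le_max_of_le_right ?_
      by_contra! hp
      exact hS' (Relation.ReflTransGen.tail hvS ⟨⟨e, he, rfl⟩, hE, hp⟩)
    · exact le_max_right _ _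
    · exact le_max_right _ _

/-! ### Crossing of lattice walks -/

/-- The indicator, modulo 2, of the event that `p` lies strictly above `(x, y)` in its column. -/
def aboveInd (p : ℤ × ℤ) (x y : ℤ) : ZMod 2 := if p.1 = x ∧ y < p.2 then 1 else 0

/-- Along a walk in `P` from `p` to `q` count, modulo 2, the horizontal steps between the columns
`x` and `x + 1` above height `y`; let `C x y` be the result.  The counts on both sides of a
point off the walk agree, except for the contribution of the end points of the walk: these count
the passages of the walk into and out of the vertical ray above the point. -/
lemma exists_crossing_count {E : ℤ × ℤ → ℤ × ℤ → Prop} {P : Set (ℤ × ℤ)} {p q : ℤ × ℤ}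
    (hp : p ∈ P) (h : Relation.ReflTransGen (StepInto E P) p q) :
    ∃ C : ℤ → ℤ → ZMod 2,
      (∀ x y, ((x, y) ∉ P ∨ (x + 1, y) ∉ P) → C x y = C x (y - 1)) ∧
      (∀ x y, (x, y) ∉ P → C (x - 1) y + C x y = aboveInd p x y + aboveInd q x y) ∧
      (∀ x y, (∀ y' > y, ¬ E (x, y') (x + 1, y') ∧ ¬ E (x + 1, y') (x, y')) → C x y = 0) := by
  induction h with
  | refl => exact ⟨fun _ _ => 0, by simp, fun x y _ => by simp [CharTwo.add_self_eq_zero], by simp⟩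
  | @tail b c hpb hbc ih =>
    obtain ⟨C, h1, h2, h3⟩ := ih
    have hbP : b ∈ P := by
      rcases Relation.ReflTransGen.cases_tail hpb with h | ⟨w, -, h⟩
      · rwa [h]
      · exact h.2.2
    obtain ⟨⟨e, he, rfl⟩, hE, hcP⟩ := hbc
    obtain ⟨a, b⟩ := b
    -- the step from `(a, b)` is horizontal, between the columns `l` and `l + 1`, or vertical
    have hor : ∀ l : ℤ, (l, b) ∈ P → (l + 1, b) ∈ P →
        (E (l, b) (l + 1, b) ∨ E (l + 1, b) (l, b)) →
        (∀ x y, aboveInd ((a, b) + e) x y = aboveInd (a, b) x y +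
          (if x - 1 = l ∧ y < b then 1 else 0) + (if x = l ∧ y < b then 1 else 0)) →
        ∃ C : ℤ → ℤ → ZMod 2,
          (∀ x y, ((x, y) ∉ P ∨ (x + 1, y) ∉ P) → C x y = C x (y - 1)) ∧
          (∀ x y, (x, y) ∉ P → C (x - 1) y + C x y
            = aboveInd p x y + aboveInd ((a, b) + e) x y) ∧
          (∀ x y, (∀ y' > y, ¬ E (x, y') (x + 1, y') ∧ ¬ E (x + 1, y') (x, y')) →
            C x y = 0) := by
      intro l hl hr hE' hind
      refine ⟨fun x y => C x y + if x = l ∧ y < b then 1 else 0, ?_, ?_, ?_⟩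
      · intro x y hxy
        have : (x = l ∧ y < b) ↔ (x = l ∧ y - 1 < b) := by
          refine and_congr_right fun hx => ⟨fun h => by omega, fun h => ?_⟩
          rcases (show y ≤ b by omega).lt_or_eq with h | rfl
          · exact h
          · subst hx
            rcases hxy with h | h <;> contradiction
        simp only [this, h1 x y hxy]
      · intro x y hxy
        have := h2 x y hxy
        rw [hind]
        linear_combination this
      · intro x y hxy
        have : ¬ (x = l ∧ y < b) := by
          rintro ⟨rfl, hy⟩
          have := hxy b hy
          tauto
        simp [this, h3 x y hxy]
    simp only [unitSteps, Finset.mem_insert, Finset.mem_singleton] at he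
    have two : (1 : ZMod 2) + 1 = 0 := by decide
    rcases he with rfl | rfl | rfl | rfl
    · refine hor a hbP (by simpa using hcP) (Or.inl (by simpa using hE)) fun x y => ?_
      simp only [aboveInd, Prod.mk_add_mk, add_zero]
      split_ifs <;> first | omega | simp [two]
    · refine hor (a - 1) (by simpa [sub_eq_add_neg] using hcP) (by simpa using hbP)
        (Or.inr (by simpa [sub_eq_add_neg] using hE)) fun x y => ?_
      simp only [aboveInd, Prod.mk_add_mk, add_zero]
      split_ifs <;> first | omega | simp [two]
    all_goals
      refine ⟨C, h1, fun x y hxy => ?_, h3⟩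
      rw [h2 x y hxy]
      congr 1
      simp only [aboveInd, Prod.mk_add_mk, add_zero] at *
      congr 1
      refine propext (and_congr_right fun hx => ?_)
      subst hx
      by_contra hne
      have hy : y = b ∨ y = b + 1 ∨ y = b + -1 := by omega
      rcases hy with rfl | rfl | rfl <;> first | contradiction | omega

/-- The point `b` can be joined to the boundary of the strip `0 ≤ x ≤ m` above the point `u` of
its left side: `b` lies above `u` in the left side, or there are no horizontal edges above `b`
immediately to the right or to the left of its column. -/
def ExposedAbove (E : ℤ × ℤ → ℤ × ℤ → Prop) (m : ℤ) (u b : ℤ × ℤ) : Prop :=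
  (b.1 = 0 ∧ u.2 < b.2) ∨
  (b.1 < m ∧ ∀ y' > b.2, ¬ E (b.1, y') (b.1 + 1, y') ∧ ¬ E (b.1 + 1, y') (b.1, y')) ∨
  (0 < b.1 ∧ ∀ y' > b.2, ¬ E (b.1 - 1, y') (b.1, y') ∧ ¬ E (b.1, y') (b.1 - 1, y'))

/-- A walk from the left side of the strip to its right side and a walk from a point above the
former to a point below it have a common point. -/
lemma walks_cross {E : ℤ × ℤ → ℤ × ℤ → Prop} {m : ℤ} (hm : 0 < m)
    (hE : ∀ u v, E u v → (0 ≤ u.1 ∧ u.1 ≤ m) ∧ (0 ≤ v.1 ∧ v.1 ≤ m))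
    {P N : Set (ℤ × ℤ)} (hPN : Disjoint P N) {u b c d : ℤ × ℤ}
    (hu : u.1 = 0) (hc : c.1 = m) (hd : d.1 = m) (hdc : d.2 < c.2)
    (hb : ExposedAbove E m u b) (huP : u ∈ P) (hbN : b ∈ N) (hb0 : 0 ≤ b.1) (hbm : b.1 ≤ m)
    (huc : Relation.ReflTransGen (StepInto E P) u c) :
    ¬ Relation.ReflTransGen (StepInto E N) b d := by
  intro hbd
  obtain ⟨C, h1, h2, h3⟩ := exists_crossing_count huP huc
  have hN : ∀ z ∈ N, z ∉ P := fun z hz hz' => Set.disjoint_left.1 hPN hz' hz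
  have hleft : ∀ y, C (-1) y = 0 := fun y => h3 _ _ fun y' _ =>
    ⟨fun h => by have := hE _ _ h; simp at this, fun h => by have := hE _ _ h; simp at this⟩
  have hright : ∀ y, C m y = 0 := fun y => h3 _ _ fun y' _ =>
    ⟨fun h => by have := hE _ _ h; simp at this, fun h => by have := hE _ _ h; simp at this⟩
  -- in the interior columns the counts on both sides of a point agree
  have hmid : ∀ x y, 0 < x → x < m → (x, y) ∉ P → C (x - 1) y = C x y := by
    intro x y hx hxm hP
    have h := h2 x y hP
    rw [aboveInd, aboveInd, if_neg (by omega), if_neg (by omega), add_zero] at h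
    exact CharTwo.add_eq_zero.1 h
  -- the side of the first walk on which a point lies
  set s : ℤ × ℤ → ZMod 2 := fun z => if z.1 < m then C z.1 z.2 else C (z.1 - 1) z.2 with hs
  have hsb : s b = 0 := by
    obtain ⟨x, y⟩ := b
    have hP := hN _ hbN
    simp only [ExposedAbove] at hb hb0 hbm
    simp only [hs]
    rcases hb with ⟨rfl, hy⟩ | ⟨hx, hy⟩ | ⟨hx, hy⟩
    · have h := h2 0 y hP
      rw [aboveInd, aboveInd, if_neg (by omega), if_neg (by omega), zero_sub, hleft] at h
      simpa [hm] using h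
    · rw [if_pos hx]
      exact h3 _ _ hy
    · have h0 : C (x - 1) y = 0 := h3 _ _ (by simpa using hy)
      split_ifs with hxm
      · rw [← hmid x y hx hxm hP, h0]
      · exact h0
  have hsd : s d = 1 := by
    have hdN : d ∈ N := by
      rcases Relation.ReflTransGen.cases_tail hbd with h | ⟨w, -, h⟩
      · rwa [h]
      · exact h.2.2
    have h := h2 d.1 d.2 (hN d hdN)
    rw [aboveInd, aboveInd, if_neg (by omega), if_pos ⟨by omega, hdc⟩] at h
    have hr := hright d.2
    rw [← hd] at hr
    simp only [hs, hd, lt_irrefl, if_false]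
    rw [hr, hd] at h
    simpa using h
  have hconst : ∀ z, Relation.ReflTransGen (StepInto E N) b z → s z = 0 := by
    intro z hz
    induction hz with
    | refl => exact hsb
    | @tail v w hbv hvw ih =>
      rw [← ih]
      have hvN : v ∉ P := by
        refine hN v ?_
        rcases Relation.ReflTransGen.cases_tail hbv with h | ⟨w, -, h⟩
        · rwa [h]
        · exact h.2.2
      obtain ⟨⟨e, he, rfl⟩, hvE, hwN⟩ := hvw
      replace hwN := hN _ hwN
      have hstrip := hE _ _ hvE
      obtain ⟨x, y⟩ := v
      simp only [unitSteps, Finset.mem_insert, Finset.mem_singleton] at he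
      rcases he with rfl | rfl | rfl | rfl <;>
        simp only [Prod.mk_add_mk, add_zero] at hstrip hwN <;>
        simp only [hs, Prod.mk_add_mk, add_zero]
      · rw [if_pos (show x < m by omega), add_sub_cancel_right]
        split_ifs with hx
        · simpa using (hmid (x + 1) y (by omega) hx hwN).symm
        · rfl
      · rw [if_pos (show x + -1 < m by omega)]
        split_ifs with hx
        · exact hmid x y (by omega) hx hvN
        · rfl
      · have e1 := h1 x (y + 1) (Or.inl hwN)
        have e2 := h1 (x - 1) (y + 1) (Or.inr (by simpa using hwN))
        rw [add_sub_cancel_right] at e1 e2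
        rw [e1, e2]
      · have e1 := h1 x y (Or.inl hvN)
        have e2 := h1 (x - 1) y (Or.inr (by simpa using hvN))
        rw [e1, e2, ← sub_eq_add_neg]
  rw [hconst d hbd] at hsd
  exact zero_ne_one hsd

/-! ### Exit functions -/

/-- `f` has the properties of the function which sends `z` to the probability that the walk
started at `z` and killed on the edges outside `E` first hits the line `x = m` at `c`: it takes
values in `[0, 1]`, it is the indicator of `c` on this line, and it is harmonic off the line. -/
structure IsExitFunction (E : ℤ × ℤ → ℤ × ℤ → Prop) (m : ℤ) (c : ℤ × ℤ) (f : ℤ × ℤ → ℝ) :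
    Prop where
  nonneg : ∀ z, 0 ≤ f z
  le_one : ∀ z, f z ≤ 1
  boundary : ∀ z, z.1 = m → f z = if z = c then 1 else 0
  mean : ∀ z, z.1 ≠ m → f z = stepMean E f z

namespace IsExitFunction

variable {E E' : ℤ × ℤ → ℤ × ℤ → Prop} {m : ℤ} {c d : ℤ × ℤ} {f g f' g' : ℤ × ℤ → ℝ}

lemma eq_zero_of_notMem (hf : IsExitFunction E m c f)
    (hE : ∀ u v, E u v → (0 ≤ u.1 ∧ u.1 ≤ m) ∧ (0 ≤ v.1 ∧ v.1 ≤ m)) {z : ℤ × ℤ}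
    (hz : z.1 < 0 ∨ m < z.1) (hm : 0 < m) : f z = 0 := by
  rw [hf.mean z (by omega), stepMean, Finset.sum_eq_zero, mul_zero]
  intro e _
  rw [if_neg]
  intro h
  have := (hE _ _ h).1
  omega

/-- The planarity of the walk: seen from a point `b` above `u`, the walk is relatively more
likely to exit at the upper one, `c`, of two exit points than it is seen from `u`.  Otherwise
some combination of `f` and `g` would be positive at `u` and negative at `b`, so that `u` is
joined to `c` by points where it is positive, and `b` to `d` by points where it is negative; but
such walks cross. -/
lemma mul_le_mul_of_exposedAbove (hf : IsExitFunction E m c f) (hg : IsExitFunction E m d g)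
    (hm : 0 < m) (hE : ∀ u v, E u v → (0 ≤ u.1 ∧ u.1 ≤ m) ∧ (0 ≤ v.1 ∧ v.1 ≤ m))
    (hc : c.1 = m) (hd : d.1 = m) (hdc : d.2 < c.2) {u b : ℤ × ℤ} (hu : u.1 = 0)
    (hb : ExposedAbove E m u b) : f u * g b ≤ g u * f b := by
  by_contra! hlt
  have hgu := hg.nonneg u
  have hgb : 0 < g b := by
    refine (hg.nonneg b).lt_of_ne fun h => ?_
    rw [← h, mul_zero] at hlt
    exact absurd hlt (not_lt.2 (mul_nonneg hgu (hf.nonneg b)))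
  have hb01 : 0 ≤ b.1 ∧ b.1 ≤ m := by
    by_contra h
    exact hgb.ne' (hg.eq_zero_of_notMem hE (by omega) hm)
  -- `t / g b` is chosen strictly between `f b / g b` and `f u / g u`
  obtain ⟨t, ht, htlt⟩ : ∃ t, f b < t ∧ g u * t < f u * g b := by
    refine ⟨f b + (f u * g b - g u * f b) / 2, by linarith, ?_⟩
    have := mul_le_of_le_one_left (by linarith : 0 ≤ (f u * g b - g u * f b) / 2) (hg.le_one u)
    linarith
  set s := g b with hs
  have ht0 : 0 < t := (hf.nonneg b).trans_lt ht
  set φ : ℤ × ℤ → ℝ := fun z => s * f z - t * g z with hφ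
  have hφu : 0 < φ u := by simp only [hφ]; linarith
  have hφb : φ b < 0 := by
    simp only [hφ, ← hs]
    nlinarith
  have hcd : c ≠ d := by rintro rfl; omega
  have hmean : ∀ z, z.1 ≠ m → φ z = stepMean E φ z := fun z hz => by
    rw [hφ, stepMean_sub_mul, ← hf.mean z hz, ← hg.mean z hz]
  have hbd : ∀ z, z.1 = m → z ≠ c → φ z ≤ 0 := fun z hz hzc => by
    simp only [hφ, hf.boundary z hz, if_neg hzc]
    have := mul_nonneg ht0.le (hg.nonneg z)
    linarith
  have hbd' : ∀ z, z.1 = m → z ≠ d → 0 ≤ φ z := fun z hz hzd => by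
    simp only [hφ, hg.boundary z hz, if_neg hzd]
    have := mul_nonneg hgb.le (hf.nonneg z)
    linarith
  have hout : ∀ z, φ z ≠ 0 → 0 ≤ z.1 ∧ z.1 ≤ m := fun z hz => by
    by_contra h
    apply hz
    simp only [hφ, hg.eq_zero_of_notMem hE (z := z) (by omega) hm,
      hf.eq_zero_of_notMem hE (z := z) (by omega) hm, mul_zero, sub_zero]
  have hup : Relation.ReflTransGen (StepInto E {v | 0 < φ v}) u c := by
    refine reachable_of_pos (m := m) (M := s) (fun z => ?_) (fun z hz hzc => ?_) hφu
    · have h1 := mul_le_of_le_one_right hgb.le (hf.le_one z)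
      have h2 := mul_nonneg ht0.le (hg.nonneg z)
      simp only [hφ]
      linarith
    · have h1 := hout z hz.ne'
      have h2 : z.1 ≠ m := fun h => hz.not_ge (hbd z h hzc)
      exact ⟨h1.1, by omega, hmean z h2⟩
  have hdown : Relation.ReflTransGen (StepInto E {v | 0 < -φ v}) b d := by
    refine reachable_of_pos (m := m) (M := t) (φ := fun v => -φ v) (fun z => ?_)
      (fun z hz hzc => ?_) (by simpa using hφb)
    · have h1 := mul_le_of_le_one_right ht0.le (hg.le_one z)
      have h2 := mul_nonneg hgb.le (hf.nonneg z)
      simp only [hφ]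
      linarith
    · have h1 := hout z (by intro h; simp [h] at hz)
      have h2 : z.1 ≠ m := fun h => absurd (hbd' z h hzc) (by linarith)
      refine ⟨h1.1, by omega, ?_⟩
      rw [hmean z h2]
      simp only [stepMean, sum_unitSteps]
      split_ifs <;> ring
  refine walks_cross hm hE ?_ hu hc hd hdc hb hφu (N := {v | 0 < -φ v}) (by simpa using hφb)
    hb01.1 hb01.2 hup hdown
  refine Set.disjoint_left.2 fun v h1 h2 => ?_
  simp only [Set.mem_ofPred_eq] at h1 h2
  linarith

/-- The effect of enlarging the region `V` at its upper boundary: if all new edges which can be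
used from `V` lead to points above `u`, the walk from `u` is relatively more likely to exit
at the upper one, `c`, of two exit points in the larger region.  The combination
`f' u * g' - g' u * f'` vanishes at `u`, and it is nonpositive at the ends of the new edges by
planarity; so it is at most the same combination of `f` and `g` by the maximum principle. -/
lemma mul_le_mul_of_subgraph (hf : IsExitFunction E m c f) (hg : IsExitFunction E m d g)
    (hf' : IsExitFunction E' m c f') (hg' : IsExitFunction E' m d g')
    (hm : 0 < m) (hE' : ∀ u v, E' u v → (0 ≤ u.1 ∧ u.1 ≤ m) ∧ (0 ≤ v.1 ∧ v.1 ≤ m))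
    (hc : c.1 = m) (hd : d.1 = m) (hdc : d.2 < c.2)
    {V : Set (ℤ × ℤ)} (hV : ∀ z ∈ V, 0 ≤ z.1 ∧ z.1 ≤ m) (hEV : ∀ a b, E a b → b ∈ V)
    (hEE' : ∀ a b, E a b → E' a b) {u : ℤ × ℤ} (huV : u ∈ V) (hu : u.1 = 0)
    (hnew : ∀ a ∈ V, ∀ e ∈ unitSteps, E' a (a + e) → ¬ E a (a + e) →
      ExposedAbove E' m u (a + e)) :
    f u * g' u ≤ g u * f' u := by
  classical
  set ψ' : ℤ × ℤ → ℝ := fun z => f' u * g' z - g' u * f' z with hψ'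
  set ψ : ℤ × ℤ → ℝ := fun z => f' u * g z - g' u * f z with hψ
  set D : ℤ × ℤ → ℝ := fun z => if z ∈ V then ψ' z - ψ z else 0 with hD
  have hDu := nonpos_of_subharmonic (m := m) (ψ := D) (M := 2) (fun z => ?_) (fun z hz => ?_) u
  · simp only [hD, huV, if_true, hψ, hψ'] at hDu
    linarith
  · simp only [hD]
    split_ifs
    · simp only [hψ, hψ']
      have h1 := mul_le_one₀ (hf'.le_one u) (hg'.nonneg z) (hg'.le_one z)
      have h2 := mul_le_one₀ (hg'.le_one u) (hf.nonneg z) (hf.le_one z)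
      have h3 := mul_nonneg (hg'.nonneg u) (hf'.nonneg z)
      have h4 := mul_nonneg (hf'.nonneg u) (hg.nonneg z)
      linarith
    · norm_num
  · have hzV : z ∈ V := by
      by_contra h
      simp [hD, h] at hz
    have hzm : z.1 ≠ m := fun h => by
      simp only [hD, hzV, if_true, hψ, hψ', hf.boundary z h, hg.boundary z h,
        hf'.boundary z h, hg'.boundary z h, sub_self, lt_irrefl] at hz
    have := hV z hzV
    refine ⟨this.1, by omega, ?_⟩
    have h1 : ψ' z = stepMean E' ψ' z := by
      rw [hψ', stepMean_sub_mul, ← hf'.mean z hzm, ← hg'.mean z hzm]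
    have h2 : ψ z = stepMean E ψ z := by
      rw [hψ, stepMean_sub_mul, ← hf.mean z hzm, ← hg.mean z hzm]
    simp only [hD, hzV, if_true]
    rw [h1, h2, stepMean, stepMean, ← mul_sub, ← Finset.sum_sub_distrib]
    refine mul_le_mul_of_nonneg_left (Finset.sum_le_sum fun e he => ?_) (by norm_num)
    by_cases hEz : E z (z + e)
    · rw [if_pos (hEE' _ _ hEz), if_pos hEz, if_pos (hEV _ _ hEz)]
      exact le_max_left _ _
    · rw [if_neg hEz, sub_zero]
      refine le_max_of_le_right ?_
      split_ifs with hE'z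
      · have := hf'.mul_le_mul_of_exposedAbove hg' hm hE' hc hd hdc hu
          (hnew z hzV e he hE'z hEz)
        simp only [hψ']
        linarith
      · exact le_rfl

end IsExitFunction

open Classical in
/-- The probability that the walk started at `z` and killed on the edges outside `E` hits the
line `x = m` within `n` steps, and does so first at the point `c` of this line. -/
noncomputable def exitWithin (E : ℤ × ℤ → ℤ × ℤ → Prop) (m : ℤ) (c : ℤ × ℤ) :
    ℕ → ℤ × ℤ → ℝ
  | 0, z => if z = c then 1 else 0
  | n + 1, z => if z.1 = m then (if z = c then 1 else 0) else stepMean E (exitWithin E m c n) z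

/-- The probability that the walk started at `z` and killed on the edges outside `E` hits the
line `x = m`, and does so first at the point `c` of this line. -/
noncomputable def exitFunction (E : ℤ × ℤ → ℤ × ℤ → Prop) (m : ℤ) (c z : ℤ × ℤ) : ℝ :=
  ⨆ n, exitWithin E m c n z

section exitFunction

variable {E E' : ℤ × ℤ → ℤ × ℤ → Prop} {m : ℤ} {c : ℤ × ℤ}

lemma exitWithin_of_eq {z : ℤ × ℤ} (hz : z.1 = m) (n : ℕ) :
    exitWithin E m c n z = if z = c then 1 else 0 := by
  cases n <;> simp [exitWithin, hz]

lemma exitWithin_nonneg (n : ℕ) : ∀ z, 0 ≤ exitWithin E m c n z := by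
  induction n with
  | zero => intro z; simp only [exitWithin]; split_ifs <;> norm_num
  | succ n ih =>
    intro z
    simp only [exitWithin]
    split_ifs
    · norm_num
    · norm_num
    · exact mul_nonneg (by norm_num) (Finset.sum_nonneg fun e _ => by
        split_ifs
        exacts [ih _, le_rfl])

lemma exitWithin_le_one (n : ℕ) : ∀ z, exitWithin E m c n z ≤ 1 := by
  classical
  induction n with
  | zero => intro z; simp only [exitWithin]; split_ifs <;> norm_num
  | succ n ih =>
    intro z
    simp only [exitWithin]
    split_ifs
    · norm_num
    · norm_num
    · have h : ∀ e, (if E z (z + e) then exitWithin E m c n (z + e) else 0) ≤ 1 := fun e => by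
        split_ifs
        exacts [ih _, zero_le_one]
      rw [stepMean, sum_unitSteps]
      linarith [h (1, 0), h (-1, 0), h (0, 1), h (0, -1)]

lemma exitWithin_mono_graph (h : ∀ a b, E a b → E' a b) (n : ℕ) :
    ∀ z, exitWithin E m c n z ≤ exitWithin E' m c n z := by
  induction n with
  | zero => intro z; exact le_rfl
  | succ n ih =>
    intro z
    simp only [exitWithin]
    split_ifs
    · exact le_rfl
    · exact le_rfl
    · exact stepMean_mono (fun e _ => h _ _) (fun e _ _ => ih _) (exitWithin_nonneg n)

lemma exitWithin_le_succ (hc : c.1 = m) (n : ℕ) :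
    ∀ z, exitWithin E m c n z ≤ exitWithin E m c (n + 1) z := by
  induction n with
  | zero =>
    intro z
    by_cases hz : z.1 = m
    · rw [exitWithin_of_eq hz, exitWithin_of_eq hz]
    · rw [exitWithin, if_neg (by rintro rfl; exact hz hc)]
      exact exitWithin_nonneg _ _
  | succ n ih =>
    intro z
    rw [exitWithin, exitWithin]
    split_ifs
    · exact le_rfl
    · exact le_rfl
    · exact stepMean_mono (fun e _ => id) (fun e _ _ => ih _) (exitWithin_nonneg _)

lemma bddAbove_exitWithin (z : ℤ × ℤ) : BddAbove (Set.range fun n => exitWithin E m c n z) :=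
  ⟨1, by rintro _ ⟨n, rfl⟩; exact exitWithin_le_one n z⟩

lemma tendsto_exitWithin (hc : c.1 = m) (z : ℤ × ℤ) :
    Filter.Tendsto (fun n => exitWithin E m c n z) Filter.atTop
      (nhds (exitFunction E m c z)) :=
  tendsto_atTop_ciSup (monotone_nat_of_le_succ fun n => exitWithin_le_succ hc n z)
    (bddAbove_exitWithin z)

lemma isExitFunction_exitFunction (hc : c.1 = m) :
    IsExitFunction E m c (exitFunction E m c) where
  nonneg z := ge_of_tendsto' (tendsto_exitWithin hc z) fun n => exitWithin_nonneg n z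
  le_one z := le_of_tendsto' (tendsto_exitWithin hc z) fun n => exitWithin_le_one n z
  boundary z hz := by simp only [exitFunction, exitWithin_of_eq hz, ciSup_const]
  mean z hz := by
    have h1 : Filter.Tendsto (fun n => stepMean E (exitWithin E m c n) z) Filter.atTop
        (nhds (stepMean E (exitFunction E m c) z)) := by
      unfold stepMean
      refine Filter.Tendsto.const_mul _ (tendsto_finsetSum _ fun e _ => ?_)
      split_ifs
      exacts [tendsto_exitWithin hc _, tendsto_const_nhds]
    have h2 := (Filter.tendsto_add_atTop_iff_nat 1).2 (tendsto_exitWithin (E := E) hc z)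
    simp only [exitWithin, if_neg hz] at h2
    exact tendsto_nhds_unique h2 h1

lemma exitFunction_mono_graph (hc : c.1 = m) (h : ∀ a b, E a b → E' a b) (z : ℤ × ℤ) :
    exitFunction E m c z ≤ exitFunction E' m c z :=
  le_of_tendsto_of_tendsto' (tendsto_exitWithin hc z) (tendsto_exitWithin hc z)
    fun n => exitWithin_mono_graph h n z

lemma stepMean_translate (φ : ℤ × ℤ → ℝ) (t z : ℤ × ℤ) :
    stepMean (fun a b => E (a - t) (b - t)) (fun w => φ (w - t)) z = stepMean E φ (z - t) := by
  unfold stepMean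
  congr 1
  refine Finset.sum_congr rfl fun e _ => ?_
  rw [sub_add_eq_add_sub]

lemma stepMean_reflect (φ : ℤ × ℤ → ℝ) (z : ℤ × ℤ) :
    stepMean (fun a b => E (a.1, -a.2) (b.1, -b.2)) (fun w => φ (w.1, -w.2)) z
      = stepMean E φ (z.1, -z.2) := by
  unfold stepMean
  congr 1
  refine Finset.sum_nbij' (fun e => (e.1, -e.2)) (fun e => (e.1, -e.2)) (by decide) (by decide)
    (fun e _ => by simp) (fun e _ => by simp) fun e _ => ?_
  have h : (((z + e).1, -(z + e).2) : ℤ × ℤ) = (z.1, -z.2) + (e.1, -e.2) := by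
    ext
    · rfl
    · exact neg_add _ _
  rw [← h]

/-- The exit probabilities do not change under a translation in the direction of the strip. -/
lemma exitFunction_translate (t : ℤ × ℤ) (ht : t.1 = 0) (z : ℤ × ℤ) :
    exitFunction (fun a b => E (a - t) (b - t)) m c z = exitFunction E m (c - t) (z - t) := by
  have : ∀ n, exitWithin (fun a b => E (a - t) (b - t)) m c n
      = fun z => exitWithin E m (c - t) n (z - t) := by
    intro n
    induction n with
    | zero => ext z; simp only [exitWithin, sub_left_inj]
    | succ n ih =>
      ext z
      rw [exitWithin, exitWithin, ih, stepMean_translate]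
      simp only [sub_left_inj, Prod.fst_sub, ht, sub_zero]
  simp only [exitFunction, this]

/-- The exit probabilities do not change under a reflection which exchanges the two ends of the
strip. -/
lemma exitFunction_reflect (z : ℤ × ℤ) :
    exitFunction (fun a b => E (a.1, -a.2) (b.1, -b.2)) m c z
      = exitFunction E m (c.1, -c.2) (z.1, -z.2) := by
  have hinj : ∀ z : ℤ × ℤ, ((z.1, -z.2) = (c.1, -c.2)) ↔ z = c := fun z => by
    simp [Prod.ext_iff]
  have : ∀ n, exitWithin (fun a b => E (a.1, -a.2) (b.1, -b.2)) m c n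
      = fun z => exitWithin E m (c.1, -c.2) n (z.1, -z.2) := by
    intro n
    induction n with
    | zero => ext z; simp only [exitWithin, hinj]
    | succ n ih =>
      ext z
      rw [exitWithin, exitWithin, ih,
        stepMean_reflect (φ := exitWithin E m (c.1, -c.2) n)]
      simp only [hinj]
  simp only [exitFunction, this]

end exitFunction

/-! ### Log-concavity for strips without lower boundary -/

/-- `V` and `E` are the vertices and the edges of a region in the strip `0 ≤ x ≤ m` without
lower boundary: with each vertex and each horizontal edge it contains all those below it, and it
contains each vertical edge whose end points belong to it. -/
structure IsDownwardStrip (m : ℤ) (V : Set (ℤ × ℤ)) (E : ℤ × ℤ → ℤ × ℤ → Prop) : Prop where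
  strip : ∀ z ∈ V, 0 ≤ z.1 ∧ z.1 ≤ m
  left_mem : ∀ a b, E a b → a ∈ V
  right_mem : ∀ a b, E a b → b ∈ V
  symm : ∀ x y, E (x + 1, y) (x, y) ↔ E (x, y) (x + 1, y)
  vertex_down : ∀ x y, (x, y) ∈ V → (x, y - 1) ∈ V
  edge_down : ∀ a b, E a b → E (a - (0, 1)) (b - (0, 1))
  vertical : ∀ x y, (x, y) ∈ V → (x, y + 1) ∈ V → E (x, y) (x, y + 1) ∧ E (x, y + 1) (x, y)

namespace IsDownwardStrip

variable {m : ℤ} {V : Set (ℤ × ℤ)} {E : ℤ × ℤ → ℤ × ℤ → Prop}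

lemma mem_of_le (h : IsDownwardStrip m V E) {x y y' : ℤ} (hy : y' ≤ y) (hV : (x, y) ∈ V) :
    (x, y') ∈ V := by
  obtain ⟨n, rfl⟩ := Int.le.dest hy
  induction n with
  | zero => simpa using hV
  | succ n ih =>
    refine ih (by omega) ?_
    have := h.vertex_down _ _ hV
    rwa [show y' + ((n + 1 : ℕ) : ℤ) - 1 = y' + n by push_cast; ring] at this

lemma edge_of_le (h : IsDownwardStrip m V E) {x y y' : ℤ} (hy : y' ≤ y)
    (hE : E (x, y) (x + 1, y)) : E (x, y') (x + 1, y') := by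
  obtain ⟨n, rfl⟩ := Int.le.dest hy
  induction n with
  | zero => simpa using hE
  | succ n ih =>
    refine ih (by omega) ?_
    have := h.edge_down _ _ hE
    rwa [Prod.mk_sub_mk, Prod.mk_sub_mk, sub_zero, sub_zero,
      show y' + ((n + 1 : ℕ) : ℤ) - 1 = y' + n by push_cast; ring] at this

/-- When a region without lower boundary is translated by one unit upwards, the new edges which
can be used from the old vertices lead to points above which there are no horizontal edges, at
least on one side. -/
lemma exposedAbove_of_new_edge (h : IsDownwardStrip m V E) (hm : 0 < m) (u : ℤ × ℤ)
    {a : ℤ × ℤ} (ha : a ∈ V) {e : ℤ × ℤ} (he : e ∈ unitSteps)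
    (hnew : E (a - (0, 1)) (a + e - (0, 1))) (hold : ¬ E a (a + e)) :
    ExposedAbove (fun a b => E (a - (0, 1)) (b - (0, 1))) m u (a + e) := by
  have hl := h.strip _ (h.left_mem _ _ hnew)
  have hr := h.strip _ (h.right_mem _ _ hnew)
  obtain ⟨x, y⟩ := a
  simp only [unitSteps, Finset.mem_insert, Finset.mem_singleton] at he
  rcases he with rfl | rfl | rfl | rfl <;>
    simp only [ExposedAbove, Prod.mk_add_mk, Prod.mk_sub_mk, add_zero, sub_zero] at *
  · refine Or.inr (Or.inr ⟨by omega, fun y' hy' => ?_⟩)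
    rw [add_sub_cancel_right, h.symm, and_self]
    exact fun hE => hold (h.edge_of_le (by omega) hE)
  · refine Or.inr (Or.inl ⟨by omega, fun y' hy' => ?_⟩)
    rw [h.symm, and_self]
    refine fun hE => hold ?_
    have := (h.symm _ _).2 (h.edge_of_le (show y ≤ y' - 1 by omega) hE)
    rwa [neg_add_cancel_right] at this
  · -- the point at the upper end of a new vertical edge is the top of its column
    have htop : ∀ y' > y + 1, (x, y' - 1) ∉ V := fun y' hy' hV =>
      hold (h.vertical x y ha (h.mem_of_le (by omega) hV)).1
    rcases hl.2.lt_or_eq with hx | hx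
    · exact Or.inr (Or.inl ⟨hx, fun y' hy' => ⟨fun hE => htop y' hy' (h.left_mem _ _ hE),
        fun hE => htop y' hy' (h.right_mem _ _ hE)⟩⟩)
    · exact Or.inr (Or.inr ⟨by omega, fun y' hy' => ⟨fun hE => htop y' hy' (h.right_mem _ _ hE),
        fun hE => htop y' hy' (h.left_mem _ _ hE)⟩⟩)
  · refine absurd ?_ hold
    have := (h.vertical x (y - 1) (h.vertex_down _ _ ha) (by simpa using ha)).2
    simpa [sub_eq_add_neg] using this

/-- The exit probabilities from a point `u` of the left side are log-concave.  The walk to `k - 1`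
is translated by one unit upwards, together with the region; then the exit points are `k` and
`k + 1` throughout, and their relative weights are compared first when the region grows and then
when the starting point moves up. -/
lemma exitFunction_mul_le_sq (h : IsDownwardStrip m V E) (hm : 0 < m) {u : ℤ × ℤ} (hu : u.1 = 0)
    (huV : u ∈ V) (k : ℤ) :
    exitFunction E m (m, k + 1) u * exitFunction E m (m, k - 1) u
      ≤ exitFunction E m (m, k) u ^ 2 := by
  set E' : ℤ × ℤ → ℤ × ℤ → Prop := fun a b => E (a - (0, 1)) (b - (0, 1)) with hE'
  have hf := isExitFunction_exitFunction (E := E) (m := m) (c := (m, k + 1)) rfl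
  have hg := isExitFunction_exitFunction (E := E) (m := m) (c := (m, k)) rfl
  have hf' := isExitFunction_exitFunction (E := E') (m := m) (c := (m, k + 1)) rfl
  have hg' := isExitFunction_exitFunction (E := E') (m := m) (c := (m, k)) rfl
  have hstrip : ∀ u v, E' u v → (0 ≤ u.1 ∧ u.1 ≤ m) ∧ (0 ≤ v.1 ∧ v.1 ≤ m) := fun u v huv => by
    have h1 := h.strip _ (h.left_mem _ _ huv)
    have h2 := h.strip _ (h.right_mem _ _ huv)
    simp only [Prod.fst_sub, sub_zero] at h1 h2
    exact ⟨h1, h2⟩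
  have hk : (m, k).2 < (m, k + 1).2 := lt_add_one k
  have h1 := hf.mul_le_mul_of_subgraph hg hf' hg' hm hstrip rfl rfl hk h.strip h.right_mem
    h.edge_down huV hu fun a ha e he hnew hold => h.exposedAbove_of_new_edge hm u ha he hnew hold
  have h2 := hf'.mul_le_mul_of_exposedAbove hg' hm hstrip rfl rfl hk (b := u + (0, 1)) hu
    (Or.inl ⟨by simp [hu], by simp⟩)
  have e1 : exitFunction E' m (m, k + 1) (u + (0, 1)) = exitFunction E m (m, k) u := by
    rw [hE', exitFunction_translate _ rfl]; simp
  have e2 : exitFunction E' m (m, k) (u + (0, 1)) = exitFunction E m (m, k - 1) u := by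
    rw [hE', exitFunction_translate _ rfl]; simp
  rw [e1, e2] at h2
  have hle := exitFunction_mono_graph (E' := E') (c := (m, k + 1)) rfl h.edge_down u
  have hp := hg.nonneg u
  have hq := (isExitFunction_exitFunction (E := E) (m := m) (c := (m, k - 1)) rfl).nonneg u
  rw [sq]
  rcases (hg'.nonneg u).eq_or_lt with h0 | h0
  · -- if the middle term of the comparison vanishes, then so does the left-hand side
    rw [← h0, zero_mul] at h2
    exact ((mul_le_mul_of_nonneg_right hle hq).trans h2).trans (mul_self_nonneg _)
  · refine le_of_mul_le_mul_right ?_ h0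
    calc _ = exitFunction E m (m, k + 1) u * exitFunction E' m (m, k) u
              * exitFunction E m (m, k - 1) u := by ring
      _ ≤ exitFunction E m (m, k) u * exitFunction E' m (m, k + 1) u
              * exitFunction E m (m, k - 1) u := mul_le_mul_of_nonneg_right h1 hq
      _ = exitFunction E m (m, k) u * (exitFunction E' m (m, k + 1) u
              * exitFunction E m (m, k - 1) u) := by ring
      _ ≤ exitFunction E m (m, k) u * (exitFunction E' m (m, k) u * exitFunction E m (m, k) u) :=
          mul_le_mul_of_nonneg_left h2 hp
      _ = _ := by ring

end IsDownwardStrip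

/-! ### Exit probabilities of the simple random walk -/

namespace InfiniteStrip

variable (Γ : InfiniteStrip)

lemma eq_of_absorbed_eq_some {x : ℕ → ℤ × ℤ} {t : ℕ} {v : ℤ × ℤ}
    (h : Γ.absorbed x t = some v) : x t = v := by
  cases t with
  | zero => simpa [absorbed] using h
  | succ t =>
    simp only [absorbed, Option.bind_eq_some_iff] at h
    obtain ⟨u, -, h⟩ := h
    split_ifs at h
    exact Option.some.inj h

lemma absorbed_congr {x y : ℕ → ℤ × ℤ} {t : ℕ} (h : ∀ j ≤ t, x j = y j) :
    Γ.absorbed x t = Γ.absorbed y t := by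
  induction t with
  | zero => simp [absorbed, h 0 le_rfl]
  | succ t ih => rw [absorbed, absorbed, ih fun j hj => h j (by omega), h (t + 1) le_rfl]

lemma absorbed_succ_of_some {x : ℕ → ℤ × ℤ} {t : ℕ} (h : Γ.absorbed x t = some (x t))
    (hs : Γ.StepInside (x t) (x (t + 1))) : Γ.absorbed x (t + 1) = some (x (t + 1)) := by
  simp [absorbed, h, hs]

lemma absorbed_eq_none_of_lt {x : ℕ → ℤ × ℤ} {t : ℕ}
    (hs : ¬ Γ.StepInside (x t) (x (t + 1))) {j : ℕ} (hj : t < j) : Γ.absorbed x j = none := by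
  induction j, hj using Nat.le_induction with
  | base =>
    cases h : Γ.absorbed x t with
    | none => simp [absorbed, h]
    | some u =>
      obtain rfl := Γ.eq_of_absorbed_eq_some h
      simp [absorbed, h, hs]
  | succ j _ ih => simp [absorbed, ih]

/-- The absorbed trajectory `x` first visits the right side at `(m, k)`, not later than at
time `n`. -/
def ExitsWithin (x : ℕ → ℤ × ℤ) (k : ℤ) (n : ℕ) : Prop :=
  ∃ T ≤ n, Γ.absorbed x T = some ((Γ.m : ℤ), k) ∧ ∀ t < T, ∀ v ∈ Γ.β, Γ.absorbed x t ≠ some v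

/-- A trajectory which reaches the right side at time `t` for the first time exits there. -/
lemma exitsWithin_iff_of_fst_eq {x : ℕ → ℤ × ℤ} {k : ℤ} {t n : ℕ} (htn : t ≤ n)
    (h : Γ.absorbed x t = some (x t)) (hmem : x t ∈ Γ.points) (hxt : (x t).1 = Γ.m)
    (hlt : ∀ j < t, (x j).1 ≠ Γ.m) : Γ.ExitsWithin x k n ↔ x t = ((Γ.m : ℤ), k) := by
  constructor
  · rintro ⟨T, -, hT, hfirst⟩
    rcases lt_trichotomy T t with hTt | rfl | hTt
    · exact absurd (by rw [Γ.eq_of_absorbed_eq_some hT]) (hlt T hTt)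
    · exact Γ.eq_of_absorbed_eq_some hT
    · exact absurd h (hfirst t hTt _ ⟨hmem, hxt⟩)
  · intro hx
    refine ⟨t, htn, by rw [h, hx], fun j hj v hv hjv => hlt j hj ?_⟩
    rw [Γ.eq_of_absorbed_eq_some hjv]
    exact hv.2

lemma not_exitsWithin_of_fst_ne {x : ℕ → ℤ × ℤ} {k : ℤ} {t : ℕ}
    (h : ∀ j ≤ t, (x j).1 ≠ Γ.m) : ¬ Γ.ExitsWithin x k t := by
  rintro ⟨T, hTt, hT, -⟩
  exact h T hTt (by rw [Γ.eq_of_absorbed_eq_some hT])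

end InfiniteStrip

namespace IsSimpleRandomWalk

variable {Ω : Type*} [MeasurableSpace Ω] {μ : Measure Ω}
  {X : ℕ → Ω → ℤ × ℤ}

lemma measurableSet_step (hX : IsSimpleRandomWalk μ X) (t : ℕ) (e : ℤ × ℤ) :
    MeasurableSet {ω | X (t + 1) ω - X t ω = e} :=
  ((hX.measurable _).sub (hX.measurable _)) (measurableSet_singleton e)

/-- The event that the first `t` increments of the walk are `s 0, …, s (t - 1)`. -/
def cylinder (X : ℕ → Ω → ℤ × ℤ) (t : ℕ) (s : ℕ → ℤ × ℤ) : Set Ω :=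
  {ω | ∀ i < t, X (i + 1) ω - X i ω = s i}

lemma measureReal_cylinder (hX : IsSimpleRandomWalk μ X) {t : ℕ} {s : ℕ → ℤ × ℤ}
    (hs : ∀ i < t, s i ∈ unitSteps) : μ.real (cylinder X t s) = (1 / 4) ^ t := by
  have h := hX.indep.measure_inter_preimage_eq_mul (S := Finset.range t)
    (sets := fun i => {s i}) fun i _ => measurableSet_singleton _
  have h1 : cylinder X t s = ⋂ i ∈ Finset.range t,
      (fun ω => X (i + 1) ω - X i ω) ⁻¹' {s i} := by
    ext ω
    simp [cylinder]
  have h2 : ∀ i ∈ Finset.range t, μ ((fun ω => X (i + 1) ω - X i ω) ⁻¹' {s i}) = 1 / 4 :=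
    fun i hi => hX.uniform i (s i) (by simpa [unitSteps] using hs i (Finset.mem_range.1 hi))
  rw [measureReal_def, h1, h, Finset.prod_congr rfl h2]
  simp

lemma eq_sum_of_mem_cylinder (hX : IsSimpleRandomWalk μ X) {t : ℕ} {s : ℕ → ℤ × ℤ} {ω : Ω}
    (hω : ω ∈ cylinder X t s) : ∀ j ≤ t, X j ω = ∑ i ∈ Finset.range j, s i := by
  intro j hj
  rw [← Finset.sum_congr rfl fun i hi => hω i ((Finset.mem_range.1 hi).trans_le hj),
    Finset.sum_range_sub (fun i => X i ω), hX.start]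
  exact (sub_zero _).symm

/-- Decomposition of an event according to the increment of the walk at time `t`. -/
lemma measureReal_eq_sum_step [IsProbabilityMeasure μ] (hX : IsSimpleRandomWalk μ X) (t : ℕ) (S : Set Ω) :
    μ.real S = ∑ e ∈ unitSteps, μ.real (S ∩ {ω | X (t + 1) ω - X t ω = e}) := by
  have hdisj : (unitSteps : Set (ℤ × ℤ)).PairwiseDisjoint
      fun e => {ω | X (t + 1) ω - X t ω = e} := fun e _ e' _ hne =>
    Set.disjoint_left.2 fun ω h h' => hne (h.symm.trans h')
  have hmeas : ∀ e ∈ unitSteps, MeasurableSet {ω | X (t + 1) ω - X t ω = e} :=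
    fun e _ => hX.measurableSet_step t e
  set G : Set Ω := ⋃ e ∈ unitSteps, {ω | X (t + 1) ω - X t ω = e} with hG
  have hGm : MeasurableSet G := Finset.measurableSet_biUnion _ hmeas
  have hG1 : μ.real G = 1 := by
    rw [hG, measureReal_biUnion_finset hdisj hmeas, sum_unitSteps]
    simp only [measureReal_def]
    rw [hX.uniform t _ (by simp), hX.uniform t _ (by simp), hX.uniform t _ (by simp),
      hX.uniform t _ (by simp)]
    norm_num
  have hG0 : μ.real Gᶜ = 0 := by rw [probReal_compl_eq_one_sub hGm, hG1, sub_self]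
  have h1 : μ.real (S ∩ Gᶜ) = 0 :=
    le_antisymm ((measureReal_mono Set.inter_subset_right).trans hG0.le) measureReal_nonneg
  have h2 := measureReal_inter_add_sdiff (μ := μ) (s := S) hGm
  rw [Set.sdiff_eq, h1, add_zero] at h2
  have h3 := measureReal_biUnion_finset (μ := μ.restrict S) hdisj hmeas
  rw [← hG, measureReal_restrict_apply hGm, Set.inter_comm, h2] at h3
  rw [h3]
  refine Finset.sum_congr rfl fun e he => ?_
  rw [measureReal_restrict_apply (hmeas e he), Set.inter_comm]

/-- If the first `t` increments of the walk lead to the right side for the first time at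
time `t`, the walk exits there. -/
lemma measureReal_cylinder_inter_of_fst_eq (hX : IsSimpleRandomWalk μ X) (Γ : InfiniteStrip)
    (k : ℤ) {t N : ℕ} (htN : t ≤ N) {s : ℕ → ℤ × ℤ} (hs : ∀ i < t, s i ∈ unitSteps)
    {w : ℕ → ℤ × ℤ} (hw : ∀ j, w j = ∑ i ∈ Finset.range j, s i)
    (hal : Γ.absorbed w t = some (w t)) (hmem : w t ∈ Γ.points)
    (hlt : ∀ j < t, (w j).1 ≠ Γ.m) (hm : (w t).1 = Γ.m) :
    μ.real (cylinder X t s ∩ {ω | Γ.ExitsWithin (fun t => X t ω) k N})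
      = (1 / 4) ^ t * if w t = ((Γ.m : ℤ), k) then 1 else 0 := by
  have hiff : ∀ ω ∈ cylinder X t s,
      (Γ.ExitsWithin (fun t => X t ω) k N ↔ w t = ((Γ.m : ℤ), k)) := by
    intro ω hω
    have h : ∀ j ≤ t, X j ω = w j := fun j hj => by
      rw [hX.eq_sum_of_mem_cylinder hω j hj, hw]
    rw [← h t le_rfl]
    refine Γ.exitsWithin_iff_of_fst_eq htN ?_ ?_ ?_ fun j hj => ?_
    · rw [Γ.absorbed_congr h, hal, h t le_rfl]
    · rwa [h t le_rfl]
    · rwa [h t le_rfl]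
    · rw [h j hj.le]
      exact hlt j hj
  split_ifs with hk
  · have hset : cylinder X t s ∩ {ω | Γ.ExitsWithin (fun t => X t ω) k N} = cylinder X t s :=
      Set.inter_eq_left.2 fun ω hω => (hiff ω hω).2 hk
    rw [hset, hX.measureReal_cylinder hs, mul_one]
  · have hset : cylinder X t s ∩ {ω | Γ.ExitsWithin (fun t => X t ω) k N} = ∅ :=
      Set.eq_empty_of_forall_notMem fun ω hω => hk ((hiff ω hω.1).1 hω.2)
    rw [hset, measureReal_empty, mul_zero]

/-- The Markov property, in the form needed here: given its first `t` increments, the walk exits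
at `(m, k)` within `n` more steps with the probability that is computed from its position at
time `t`, provided that it is still in the region then and has not visited the right side. -/
lemma measureReal_cylinder_inter_exitsWithin [IsProbabilityMeasure μ]
    (hX : IsSimpleRandomWalk μ X) (Γ : InfiniteStrip) (k : ℤ) (n : ℕ) :
    ∀ (t : ℕ) (s : ℕ → ℤ × ℤ), (∀ i < t, s i ∈ unitSteps) →
    ∀ w : ℕ → ℤ × ℤ, (∀ j, w j = ∑ i ∈ Finset.range j, s i) →
    Γ.absorbed w t = some (w t) → w t ∈ Γ.points → (∀ j < t, (w j).1 ≠ Γ.m) →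
    μ.real (cylinder X t s ∩ {ω | Γ.ExitsWithin (fun t => X t ω) k (t + n)})
      = (1 / 4) ^ t * exitWithin Γ.StepInside Γ.m (Γ.m, k) n (w t) := by
  induction n with
  | zero =>
    intro t s hs w hw hal hmem hlt
    by_cases hm : (w t).1 = Γ.m
    · rw [exitWithin_of_eq hm]
      exact hX.measureReal_cylinder_inter_of_fst_eq Γ k le_rfl hs hw hal hmem hlt hm
    · have hset : cylinder X t s ∩ {ω | Γ.ExitsWithin (fun t => X t ω) k (t + 0)} = ∅ := by
        refine Set.eq_empty_of_forall_notMem fun ω hω =>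
          Γ.not_exitsWithin_of_fst_ne (fun j hj => ?_) hω.2
        rw [hX.eq_sum_of_mem_cylinder hω.1 j hj, ← hw]
        rcases hj.lt_or_eq with h | rfl
        exacts [hlt j h, hm]
      rw [hset, exitWithin, if_neg fun h => hm (by rw [h]), measureReal_empty, mul_zero]
  | succ n ih =>
    intro t s hs w hw hal hmem hlt
    by_cases hm : (w t).1 = Γ.m
    · rw [exitWithin_of_eq hm]
      exact hX.measureReal_cylinder_inter_of_fst_eq Γ k (by omega) hs hw hal hmem hlt hm
    · rw [hX.measureReal_eq_sum_step t, exitWithin, if_neg hm, stepMean, ← mul_assoc,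
        ← pow_succ, Finset.mul_sum]
      refine Finset.sum_congr rfl fun e he => ?_
      set s' := Function.update s t e with hs'
      set w' : ℕ → ℤ × ℤ := fun j => ∑ i ∈ Finset.range j, s' i with hw'
      have hs'lt : ∀ i < t, s' i = s i := fun i hi => Function.update_of_ne hi.ne _ _
      have hs't : s' t = e := Function.update_self _ _ _
      have hw'le : ∀ j ≤ t, w' j = w j := fun j hj => by
        rw [hw, hw']
        exact Finset.sum_congr rfl fun i hi => hs'lt i ((Finset.mem_range.1 hi).trans_le hj)
      have hw'succ : w' (t + 1) = w t + e := by
        rw [← hw'le t le_rfl, ← hs't]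
        exact Finset.sum_range_succ _ _
      have hset : cylinder X t s ∩ {ω | Γ.ExitsWithin (fun t => X t ω) k (t + (n + 1))} ∩
          {ω | X (t + 1) ω - X t ω = e}
          = cylinder X (t + 1) s' ∩ {ω | Γ.ExitsWithin (fun t => X t ω) k (t + 1 + n)} := by
        rw [show t + (n + 1) = t + 1 + n by omega]
        ext ω
        have : ω ∈ cylinder X (t + 1) s' ↔ ω ∈ cylinder X t s ∧ X (t + 1) ω - X t ω = e := by
          constructor
          · intro h
            exact ⟨fun i hi => (h i (by omega)).trans (hs'lt i hi),
              (h t (by omega)).trans hs't⟩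
          · rintro ⟨h1, h2⟩ i hi
            rcases (Nat.lt_succ_iff.1 hi).lt_or_eq with h | rfl
            exacts [(h1 i h).trans (hs'lt i h).symm, h2.trans hs't.symm]
        rw [Set.mem_inter_iff, Set.mem_inter_iff, Set.mem_inter_iff, this, and_right_comm]
        rfl
      rw [hset]
      have hs'mem : ∀ i < t + 1, s' i ∈ unitSteps := fun i hi => by
        rcases (Nat.lt_succ_iff.1 hi).lt_or_eq with h | rfl
        · rw [hs'lt i h]
          exact hs i h
        · rwa [hs't]
      have hw'lt : ∀ j < t + 1, (w' j).1 ≠ Γ.m := fun j hj => by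
        rw [hw'le j (by omega)]
        rcases (Nat.lt_succ_iff.1 hj).lt_or_eq with h | rfl
        exacts [hlt j h, hm]
      split_ifs with hstep
      · have hal' : Γ.absorbed w' t = some (w' t) := by
          rw [Γ.absorbed_congr hw'le, hal, hw'le t le_rfl]
        rw [ih (t + 1) s' hs'mem w' (fun _ => rfl)
          (Γ.absorbed_succ_of_some hal' (by rwa [hw'le t le_rfl, hw'succ]))
          (by rw [hw'succ]; exact hstep.2.1) hw'lt, hw'succ]
      · rw [mul_zero]
        refine (congrArg μ.real (Set.eq_empty_of_forall_notMem fun ω hω => ?_)).trans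
          measureReal_empty
        have hXw : ∀ j ≤ t + 1, X j ω = w' j := hX.eq_sum_of_mem_cylinder hω.1
        obtain ⟨T, -, hT, -⟩ := hω.2
        rcases le_or_gt T t with hTt | hTt
        · refine hw'lt T (by omega) ?_
          rw [← hXw T (by omega), Γ.eq_of_absorbed_eq_some hT]
        · rw [Γ.absorbed_eq_none_of_lt (t := t) ?_ hTt] at hT
          · exact Option.some_ne_none _ hT.symm
          · rwa [hXw t (by omega), hXw (t + 1) le_rfl, hw'le t le_rfl, hw'succ]

/-- The exit probabilities of the walk are the values at the origin of the exit functions of the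
region. -/
lemma exitProb_eq_exitFunction [IsProbabilityMeasure μ] (hX : IsSimpleRandomWalk μ X)
    (Γ : InfiniteStrip) (hO : ((0, 0) : ℤ × ℤ) ∈ Γ.points) (k : ℤ) :
    Γ.exitProb μ X k = exitFunction Γ.StepInside Γ.m (Γ.m, k) (0, 0) := by
  have hunion : {ω | Γ.ExitsAt (fun t => X t ω) k}
      = ⋃ n, {ω | Γ.ExitsWithin (fun t => X t ω) k n} := by
    ext ω
    simp only [Set.mem_iUnion]
    exact ⟨fun ⟨T, hT⟩ => ⟨T, T, le_rfl, hT⟩, fun ⟨_, T, _, hT⟩ => ⟨T, hT⟩⟩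
  have hmono : Monotone fun n => {ω | Γ.ExitsWithin (fun t => X t ω) k n} :=
    fun n n' hn ω ⟨T, hTn, hT⟩ => ⟨T, hTn.trans hn, hT⟩
  have hval : ∀ n, μ.real {ω | Γ.ExitsWithin (fun t => X t ω) k n}
      = exitWithin Γ.StepInside Γ.m (Γ.m, k) n (0, 0) := by
    intro n
    have h := hX.measureReal_cylinder_inter_exitsWithin Γ k n 0 (fun _ => 0) (by simp)
      (fun _ => 0) (by simp) rfl hO (by simp)
    have hcyl : cylinder X 0 (fun _ => (0 : ℤ × ℤ)) = Set.univ := by simp [cylinder]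
    rw [hcyl, Set.univ_inter, zero_add, pow_zero, one_mul] at h
    exact h
  have h1 := (ENNReal.tendsto_toReal (measure_ne_top μ _)).comp
    (tendsto_measure_iUnion_atTop (μ := μ) hmono)
  rw [← hunion] at h1
  refine tendsto_nhds_unique h1 ?_
  refine (tendsto_exitWithin (m := Γ.m) rfl (0, 0)).congr fun n => ?_
  exact (hval n).symm

end IsSimpleRandomWalk

/-! ### Infinite strips -/

namespace InfiniteStrip

variable {Γ : InfiniteStrip}

lemma stepInside_symm {u v : ℤ × ℤ} (huv : u.2 = v.2) (h : Γ.StepInside u v) :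
    Γ.StepInside v u := by
  refine ⟨h.2.1, h.1, fun hne => ?_⟩
  have := h.2.2 hne.symm
  simpa only [XMonotonePath.HEdgeBelow, XMonotonePath.HEdgeAbove, min_comm u.1, max_comm u.1,
    huv] using this

lemma stepInside_of_fst_eq {u v : ℤ × ℤ} (hu : u ∈ Γ.points) (hv : v ∈ Γ.points)
    (h : u.1 = v.1) : Γ.StepInside u v :=
  ⟨hu, hv, fun hne => absurd h hne⟩

/-- A strip without lower boundary. -/
lemma isDownwardStrip_of_lower_eq_none (h : Γ.lower = none) :
    IsDownwardStrip Γ.m Γ.points Γ.StepInside := by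
  have hdown : ∀ x y, (x, y) ∈ Γ.points → (x, y - 1) ∈ Γ.points := by
    rintro x y ⟨h0, hm, hup, -⟩
    refine ⟨h0, hm, fun η hη => ?_, by simp [h]⟩
    obtain ⟨i, hi, hx, hy⟩ := hup η hη
    exact ⟨i, hi, hx, by simp only at hy ⊢; omega⟩
  refine ⟨fun z hz => ⟨hz.1, hz.2.1⟩, fun a b hab => hab.1, fun a b hab => hab.2.1,
    fun x y => ⟨stepInside_symm rfl, stepInside_symm rfl⟩, hdown, ?_,
    fun x y h1 h2 => ⟨stepInside_of_fst_eq h1 h2 rfl, stepInside_of_fst_eq h2 h1 rfl⟩⟩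
  rintro ⟨x, y⟩ ⟨x', y'⟩ ⟨h1, h2, h3⟩
  simp only [Prod.mk_sub_mk, sub_zero]
  refine ⟨hdown _ _ h1, hdown _ _ h2, fun hne => ⟨fun η hη => ?_, by simp [h]⟩⟩
  obtain ⟨i, hi, hx, hx', hy⟩ := (h3 hne).1 η hη
  exact ⟨i, hi, hx, hx', by simp only at hy ⊢; omega⟩

/-- A strip without upper boundary, reflected. -/
lemma isDownwardStrip_reflect_of_upper_eq_none (h : Γ.upper = none) :
    IsDownwardStrip Γ.m {z | (z.1, -z.2) ∈ Γ.points}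
      (fun a b => Γ.StepInside (a.1, -a.2) (b.1, -b.2)) := by
  have hdown : ∀ x y, (x, -y) ∈ Γ.points → (x, -(y - 1)) ∈ Γ.points := by
    rintro x y ⟨h0, hm, -, hlow⟩
    refine ⟨h0, hm, by simp [h], fun η hη => ?_⟩
    obtain ⟨i, hi, hx, hy⟩ := hlow η hη
    exact ⟨i, hi, hx, by simp only at hy ⊢; omega⟩
  refine ⟨fun z hz => ⟨hz.1, hz.2.1⟩, fun a b hab => hab.1, fun a b hab => hab.2.1,
    fun x y => ⟨stepInside_symm rfl, stepInside_symm rfl⟩, hdown, ?_,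
    fun x y h1 h2 => ⟨stepInside_of_fst_eq h1 h2 rfl, stepInside_of_fst_eq h2 h1 rfl⟩⟩
  rintro ⟨x, y⟩ ⟨x', y'⟩ ⟨h1, h2, h3⟩
  simp only [Prod.mk_sub_mk, sub_zero]
  refine ⟨hdown _ _ h1, hdown _ _ h2, fun hne => ⟨by simp [h], fun η hη => ?_⟩⟩
  obtain ⟨i, hi, hx, hx', hy⟩ := (h3 hne).2 η hη
  exact ⟨i, hi, hx, hx', by simp only at hy ⊢; omega⟩

end InfiniteStrip

theorem corollary4p6 {Ω : Type*} [MeasurableSpace Ω] (μ : Measure Ω) [IsProbabilityMeasure μ]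
    (X : ℕ → Ω → ℤ × ℤ) (hX : IsSimpleRandomWalk μ X)
    (Γ : InfiniteStrip) (hO : ((0, 0) : ℤ × ℤ) ∈ Γ.α)
    (k : ℤ) (hk₁ : ((Γ.m : ℤ), k + 1) ∈ Γ.β) (hk₂ : ((Γ.m : ℤ), k - 1) ∈ Γ.β) :
    Γ.exitProb μ X (k + 1) * Γ.exitProb μ X (k - 1) ≤ Γ.exitProb μ X k ^ 2 := by
  have hm : (0 : ℤ) < Γ.m := by exact_mod_cast Γ.m_pos
  rw [hX.exitProb_eq_exitFunction Γ hO.1, hX.exitProb_eq_exitFunction Γ hO.1,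
    hX.exitProb_eq_exitFunction Γ hO.1]
  rcases Γ.unbounded with h | h
  · have key := (InfiniteStrip.isDownwardStrip_reflect_of_upper_eq_none h).exitFunction_mul_le_sq
      hm (u := (0, 0)) rfl (by simpa using hO.1) (-k)
    simp only [exitFunction_reflect, neg_add, neg_sub, neg_neg, neg_zero, sub_neg_eq_add] at key
    rwa [mul_comm, add_comm 1 k, ← sub_eq_add_neg] at key
  · exact (InfiniteStrip.isDownwardStrip_of_lower_eq_none h).exitFunction_mul_le_sq
      hm rfl hO.1 k
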